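/- A Riesz space is a real vector space $A$ with a lattice order such that $a\le b$ implies $a+c\le b+c$ and $ra\le rb$ for all $c\in A$ and all real $r\ge 0$. It is Archimedean if $a=0$ whenever there is $b\in A$ with $n|a|\le |b|$ for all $n\in\mathbb N$; it is Dedekind complete if every nonempty bounded subset has a supremum and an infimum. A strong unit is an element $u\ge 0$ such that for every $a$ there is $n\in\mathbb N$ with $|a|\le nu$. A modal Riesz space $(A,u,\Diamond)$ is a Riesz space $A$ with an element $u\geq 0$ and a linear map $\Diamond:A\to A$ such that $\Diamond(a\sqcup 0)\ge 0$ for all $a$, and $\Diamond u\le u$; it is unital if $u$ is a strong unit. An embedding of Riesz spaces is an injective linear map preserving binary suprema and infima. Theorem 4.9. Let $(R,u,\Diamond)$ be an Archimedean unital modal Riesz space. Then there exist a Dedekind complete Archimedean Riesz space $\overline R$, an embedding $\iota:R\to\overline R$ and a linear map $\overline\Diamond:\overline R\to\overline R$ such that $(\overline R,\iota(u),\overline\Diamond)$ is a unital modal Riesz space and: 1. $\overline R$ is the Dedekind completion of $R$ via $\iota$, that is: (a) for every $x>0$ in $\overline R$ there is $r\in R$ with $0<\iota(r)<x$, and every $x\in\overline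 R$ is both the supremum of $\{\iota(r): r\in R,\ \iota(r)\le x\}$ and the infimum of $\{\iota(r): r\in R,\ \iota(r)\ge x\}$; (b) $\iota$ preserves all suprema and infima of subsets of $R$ that exist in $R$; (c) $\overline R$ is the smallest such space: for every Dedekind complete Riesz space $C$ and every embedding $j:R\to C$ preserving all suprema and infima of subsets of $R$ that exist in $R$, there is an embedding $k:\overline R\to C$ with $k\circ\iota=j$. 2. $\overline\Diamond$ extends $\Diamond$, i.e. $\overline\Diamond(\iota(f))=\iota(\Diamond f)$ for all $f\in R$. -/

import Mathlib

universe u v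

/-! A Riesz space (vector lattice) is a real vector space with a lattice order compatible with
addition and with multiplication by nonnegative scalars, that is, a type `A` with instances
`[AddCommGroup A] [Lattice A] [IsOrderedAddMonoid A] [Module ℝ A] [IsOrderedModule ℝ A]`. -/

namespace Riesz

section Space

variable (A : Type*) [AddCommGroup A] [Lattice A] [IsOrderedAddMonoid A]
  [Module ℝ A] [IsOrderedModule ℝ A]

/-- The only infinitely small element is `0`. (Mathlib's `Archimedean` is a different notion,
which fails for most Riesz spaces that are not totally ordered.) -/
def IsArchimedean : Prop :=
  ∀ a : A, (∃ b : A, ∀ n : ℕ, (n : ℝ) • |a| ≤ |b|) → a = 0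

/-- Every nonempty bounded subset has a supremum and an infimum. -/
def IsDedekindComplete : Prop :=
  ∀ S : Set A, S.Nonempty → BddAbove S → BddBelow S → (∃ s, IsLUB S s) ∧ (∃ i, IsGLB S i)

variable {A}

/-- `u` is a strong unit. -/
def IsStrongUnit (u : A) : Prop :=
  0 ≤ u ∧ ∀ a : A, ∃ n : ℕ, |a| ≤ (n : ℝ) • u

/-- `(A, u, D)` is a modal Riesz space; linearity of `D` is part of its type. -/
structure IsModal (u : A) (D : A →ₗ[ℝ] A) : Prop where
  unit_nonneg : 0 ≤ u
  nonneg : ∀ a : A, 0 ≤ D (a ⊔ 0)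
  unit_decreasing : D u ≤ u

end Space

section Maps

variable {A : Type*} [AddCommGroup A] [Lattice A] [IsOrderedAddMonoid A]
  [Module ℝ A] [IsOrderedModule ℝ A]
  {B : Type*} [AddCommGroup B] [Lattice B] [IsOrderedAddMonoid B]
  [Module ℝ B] [IsOrderedModule ℝ B]

/-- An injective Riesz homomorphism: an injective linear map preserving binary suprema and
infima. -/
structure IsEmbedding (f : A →ₗ[ℝ] B) : Prop where
  injective : Function.Injective f
  map_sup : ∀ a b : A, f (a ⊔ b) = f a ⊔ f b
  map_inf : ∀ a b : A, f (a ⊓ b) = f a ⊓ f b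

/-- All suprema and infima (of arbitrary subsets) that exist in `A` are preserved by `f`. -/
def PreservesBounds (f : A →ₗ[ℝ] B) : Prop :=
  ∀ (S : Set A) (a : A), (IsLUB S a → IsLUB (f '' S) (f a)) ∧ (IsGLB S a → IsGLB (f '' S) (f a))

end Maps

/-- `ι : R → B` exhibits `B` as the Dedekind completion of the Riesz space `R`. -/
structure IsDedekindCompletion {R : Type*} [AddCommGroup R] [Lattice R] [IsOrderedAddMonoid R]
    [Module ℝ R] [IsOrderedModule ℝ R]
    {B : Type*} [AddCommGroup B] [Lattice B] [IsOrderedAddMonoid B]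
    [Module ℝ B] [IsOrderedModule ℝ B] (ι : R →ₗ[ℝ] B) : Prop where
  complete : IsDedekindComplete B
  embedding : IsEmbedding ι
  /-- `R` is order-dense in `B`. -/
  orderDense : ∀ x : B, 0 < x → ∃ r : R, 0 < ι r ∧ ι r < x
  /-- Every element of `B` is the supremum of the elements of `R` below it. -/
  isLUB_below : ∀ x : B, IsLUB (Set.range ι ∩ Set.Iic x) x
  /-- Every element of `B` is the infimum of the elements of `R` above it. -/
  isGLB_above : ∀ x : B, IsGLB (Set.range ι ∩ Set.Ici x) x
  preserves : PreservesBounds ι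
  /-- `B` is the smallest Dedekind complete space of this kind: over `R`, it embeds into every
  Dedekind complete Riesz space in which `R` embeds with preservation of existing suprema and
  infima. -/
  smallest : ∀ (C : Type v) [AddCommGroup C] [Lattice C] [IsOrderedAddMonoid C]
    [Module ℝ C] [IsOrderedModule ℝ C] (j : R →ₗ[ℝ] C),
    IsDedekindComplete C → IsEmbedding j → PreservesBounds j →
    ∃ k : B →ₗ[ℝ] C, IsEmbedding k ∧ ∀ r : R, k (ι r) = j r

end Riesz

namespace Riesz

/-! The completion is the space `Cut R` of Dedekind cuts, with `r` embedded as the cut between `Iic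
r` and `Ici r`. The order properties hold for any lattice. Addition comes from sums of lower
elements, and scaling by `r ≥ 0` from multiples of lower elements; neither needs the Archimedean
property. That property enters in `Cut.neg_add_cancel`: it forces the gaps `u - l` across a cut to
have infimum `0`, so that `-x` inverts `x`.

The same gap statement gives minimality. If `j` preserves bounds, the gaps `j u - j l` also have
infimum `0`, so exactly one element of `C` separates the images of the two halves of a cut. Sending
each cut to its separator extends `j`, and uniqueness makes this map linear.

The operator is extended by Kantorovich's theorem (`exists_linearMap_nonneg_extension`): `R`
majorizes `Cut R` and the target is Dedekind complete. The inequality at the unit is inherited,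
since the extension agrees with the original operator there. -/

theorem IsDedekindComplete.exists_isLUB {A : Type*} [Lattice A] (h : IsDedekindComplete A)
    {S : Set A} (hne : S.Nonempty) (hb : BddAbove S) : ∃ s, IsLUB S s := by
  obtain ⟨s₀, hs₀⟩ := hne
  obtain ⟨b, hb⟩ := hb
  -- Joining with `s₀` bounds the set below without changing its upper bounds.
  obtain ⟨s, hs⟩ := (h ((· ⊔ s₀) '' S) ⟨_, s₀, hs₀, rfl⟩
    ⟨b, by rintro _ ⟨a, ha, rfl⟩; exact sup_le (hb ha) (hb hs₀)⟩
    ⟨s₀, by rintro _ ⟨a, -, rfl⟩; exact le_sup_right⟩).1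
  refine ⟨s, fun a ha => le_sup_left.trans (hs.1 ⟨a, ha, rfl⟩), fun c hc => hs.2 ?_⟩
  rintro _ ⟨a, ha, rfl⟩
  exact sup_le (hc ha) (hc hs₀)

theorem IsDedekindComplete.exists_between {A : Type*} [Lattice A] (h : IsDedekindComplete A)
    {S T : Set A} (hS : S.Nonempty) (hT : T.Nonempty)
    (hST : ∀ a ∈ S, ∀ b ∈ T, a ≤ b) : ∃ c, (∀ a ∈ S, a ≤ c) ∧ ∀ b ∈ T, c ≤ b := by
  obtain ⟨t, ht⟩ := hT
  obtain ⟨c, hc⟩ := h.exists_isLUB hS ⟨t, fun a ha => hST a ha t ht⟩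
  exact ⟨c, fun a ha => hc.1 ha, fun b hb => hc.2 fun a ha => hST a ha b hb⟩

section Complete

variable {A : Type*} [AddCommGroup A] [Lattice A] [IsOrderedAddMonoid A]
  [Module ℝ A] [IsOrderedModule ℝ A]

theorem IsArchimedean.nonpos_of_forall_smul_le (h : IsArchimedean A) {c d : A}
    (hcd : ∀ n : ℕ, (n : ℝ) • c ≤ d) : c ≤ 0 := by
  have key : c ⊔ 0 = 0 := by
    refine h _ ⟨d, fun n => ?_⟩
    rw [abs_of_nonneg le_sup_right]
    rcases Nat.eq_zero_or_pos n with rfl | hn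
    · simp
    · have hn' : (0 : ℝ) < n := by exact_mod_cast hn
      have : c ⊔ 0 ≤ (n : ℝ)⁻¹ • |d| := by
        refine sup_le ?_ (smul_nonneg (by positivity) (abs_nonneg d))
        rw [le_inv_smul_iff_of_pos hn']
        exact (hcd n).trans (le_abs_self d)
      rwa [le_inv_smul_iff_of_pos hn'] at this
  exact sup_eq_right.1 key

theorem IsDedekindComplete.isArchimedean (h : IsDedekindComplete A) : IsArchimedean A := by
  rintro a ⟨b, hb⟩
  obtain ⟨s, hs⟩ := h.exists_isLUB (S := Set.range fun n : ℕ => (n : ℝ) • |a|) ⟨_, 0, rfl⟩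
    ⟨|b|, by rintro _ ⟨n, rfl⟩; exact hb n⟩
  -- The set of multiples of `|a|` absorbs adding `|a|`, so `s - |a|` also bounds it.
  have : s ≤ s - |a| := hs.2 (by
    rintro _ ⟨n, rfl⟩
    rw [le_sub_iff_add_le]
    have := hs.1 ⟨n + 1, rfl⟩
    simpa [add_smul] using this)
  have : |a| ≤ 0 := by simpa using this
  exact le_antisymm ((le_abs_self a).trans this) (neg_nonpos.1 ((neg_le_abs a).trans this))

end Complete

/-! Kantorovich's extension theorem: a positive map defined on a majorizing subspace, with values
in a Dedekind complete Riesz space, has a positive extension. -/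

section Extension

variable {E F : Type*} [AddCommGroup E] [PartialOrder E] [IsOrderedAddMonoid E]
  [Module ℝ E] [IsOrderedModule ℝ E]
  [AddCommGroup F] [Lattice F] [IsOrderedAddMonoid F] [Module ℝ F] [IsOrderedModule ℝ F]

/-- To extend to a new vector `y`, its value `c` must lie between the values of `f` below `y` and
those above `y`. Positivity orders these two sets, majorization makes them nonempty, and
completeness of `F` supplies `c`. -/
theorem exists_lt_linearPMap_nonneg (hF : IsDedekindComplete F) (f : E →ₗ.[ℝ] F)
    (nonneg : ∀ x : f.domain, 0 ≤ (x : E) → 0 ≤ f x)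
    (dense : ∀ y, ∃ x : f.domain, y ≤ (x : E)) (hdom : f.domain ≠ ⊤) :
    ∃ g, f < g ∧ ∀ x : g.domain, 0 ≤ (x : E) → 0 ≤ g x := by
  obtain ⟨y, -, hy⟩ : ∃ y ∈ ⊤, y ∉ f.domain := SetLike.exists_of_lt (lt_top_iff_ne_top.2 hdom)
  obtain ⟨c, le_c, c_le⟩ :
      ∃ c, (∀ x : f.domain, (x : E) ≤ y → f x ≤ c) ∧
        ∀ x : f.domain, y ≤ (x : E) → c ≤ f x := by
    have := hF.exists_between (S := f '' { x : f.domain | (x : E) ≤ y })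
      (T := f '' { x : f.domain | y ≤ (x : E) }) ?_ ?_ ?_
    · simpa only [Set.forall_mem_image, Set.mem_ofPred_eq] using this
    · obtain ⟨x, hx⟩ := dense (-y)
      exact ⟨_, -x, by simpa using neg_le.1 hx, rfl⟩
    · obtain ⟨x, hx⟩ := dense y
      exact ⟨_, x, hx, rfl⟩
    · rintro _ ⟨a, ha, rfl⟩ _ ⟨b, hb, rfl⟩
      rw [← sub_nonneg, ← f.map_sub]
      exact nonneg _ (sub_nonneg.2 (le_trans (α := E) ha hb))
  refine ⟨f.supSpanSingleton y c hy, ?_, ?_⟩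
  · refine lt_iff_le_not_ge.2 ⟨f.left_le_sup _ _, fun H => ?_⟩
    replace H := LinearPMap.domain_mono.monotone H
    rw [LinearPMap.domain_supSpanSingleton, sup_le_iff, Submodule.span_le,
      Set.singleton_subset_iff] at H
    exact hy H.2
  · rintro ⟨z, hz⟩ hzs
    rcases Submodule.mem_sup.1 hz with ⟨x, hx, y', hy', rfl⟩
    rcases Submodule.mem_span_singleton.1 hy' with ⟨r, rfl⟩
    simp only at hzs
    rw [LinearPMap.supSpanSingleton_apply_mk _ _ _ _ _ hx]
    -- Dividing `0 ≤ x + r • y` by `|r|` compares `y` with a domain vector, from above if `r < 0`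
    -- and from below if `r > 0`; the matching bound on `c` applies.
    rcases lt_trichotomy r 0 with (hr | rfl | hr)
    · have hr' : 0 < -r := neg_pos.2 hr
      have h1 : y ≤ ((-r)⁻¹ • (⟨x, hx⟩ : f.domain) : f.domain) := by
        change y ≤ (-r)⁻¹ • x
        rw [le_inv_smul_iff_of_pos hr', neg_smul]
        exact neg_le_iff_add_nonneg.2 hzs
      have h2 := c_le _ h1
      rw [f.map_smul, le_inv_smul_iff_of_pos hr', neg_smul] at h2
      exact neg_le_iff_add_nonneg.1 h2
    · simp only [zero_smul, add_zero] at hzs ⊢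
      rw [RingHom.id_apply, zero_smul, add_zero]
      exact nonneg _ hzs
    · have h1 : ((-r⁻¹ • (⟨x, hx⟩ : f.domain) : f.domain) : E) ≤ y := by
        change -r⁻¹ • x ≤ y
        rw [neg_smul, ← smul_neg, inv_smul_le_iff_of_pos hr]
        exact neg_le_iff_add_nonneg'.2 hzs
      have h2 := le_c _ h1
      rw [f.map_smul, neg_smul, ← smul_neg, inv_smul_le_iff_of_pos hr] at h2
      exact neg_le_iff_add_nonneg'.1 h2

theorem exists_linearMap_nonneg_extension (hF : IsDedekindComplete F) (p : E →ₗ.[ℝ] F)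
    (nonneg : ∀ x : p.domain, 0 ≤ (x : E) → 0 ≤ p x)
    (dense : ∀ y, ∃ x : p.domain, y ≤ (x : E)) :
    ∃ g : E →ₗ[ℝ] F, (∀ x : p.domain, g x = p x) ∧ ∀ x, 0 ≤ x → 0 ≤ g x := by
  let S := { p : E →ₗ.[ℝ] F | ∀ x : p.domain, 0 ≤ (x : E) → 0 ≤ p x }
  have hSc : ∀ c, c ⊆ S → IsChain (· ≤ ·) c → ∀ y ∈ c, ∃ ub ∈ S, ∀ z ∈ c, z ≤ ub := by
    intro c hcs c_chain y hy
    have hcd : DirectedOn (· ≤ ·) c := c_chain.directedOn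
    refine ⟨LinearPMap.sSup c hcd, ?_, fun _ ↦ LinearPMap.le_sSup hcd⟩
    rintro ⟨x, hx⟩ hxs
    have hdir : DirectedOn (· ≤ ·) (LinearPMap.domain '' c) :=
      directedOn_image.2 (hcd.mono LinearPMap.domain_mono.monotone)
    rcases (Submodule.mem_sSup_of_directed (Set.Nonempty.image _ ⟨y, hy⟩) hdir).1 hx with
      ⟨_, ⟨f, hfc, rfl⟩, hfx⟩
    have : f ≤ LinearPMap.sSup c hcd := LinearPMap.le_sSup _ hfc
    rw [← this.2 (x := ⟨x, hfx⟩) rfl]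
    exact hcs hfc ⟨x, hfx⟩ hxs
  obtain ⟨q, hpq, hqs, hq⟩ := zorn_le_nonempty₀ S hSc p nonneg
  have hq_top : q.domain = ⊤ := by
    contrapose! hq
    have hqd : ∀ y, ∃ x : q.domain, y ≤ (x : E) := fun y ↦
      let ⟨x, hx⟩ := dense y
      ⟨Submodule.inclusion hpq.left x, hx⟩
    rcases exists_lt_linearPMap_nonneg hF q hqs hqd hq with ⟨r, hqr, hr⟩
    exact ⟨r, hr, hqr.le, fun hrq ↦ hqr.ne' <| hrq.antisymm hqr.le⟩
  obtain ⟨q_dom, g⟩ := q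
  obtain rfl : q_dom = ⊤ := hq_top
  exact ⟨g.comp (LinearMap.id.codRestrict ⊤ fun _ ↦ trivial), fun x => (hpq.2 rfl).symm,
    fun x hx => hqs ⟨x, trivial⟩ hx⟩

end Extension

/-! ### Dedekind cuts as a complete lattice -/

open Set

/-- A Dedekind cut of `R`: a pair of nonempty sets each of which is the set of all bounds of the
other. -/
structure Cut (R : Type*) [Lattice R] where
  lower : Set R
  upper : Set R
  lower_nonempty : lower.Nonempty
  upper_nonempty : upper.Nonempty
  lowerBounds_upper : lowerBounds upper = lower
  upperBounds_lower : upperBounds lower = upper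

namespace Cut

section Order

variable {R : Type*} [Lattice R] {x y : Cut R} {a b : R}

theorem mem_lower : a ∈ x.lower ↔ ∀ u ∈ x.upper, a ≤ u := by
  rw [← x.lowerBounds_upper]; rfl

theorem mem_upper : a ∈ x.upper ↔ ∀ l ∈ x.lower, l ≤ a := by
  rw [← x.upperBounds_lower]; rfl

theorem lower_le_upper (ha : a ∈ x.lower) (hb : b ∈ x.upper) : a ≤ b := mem_lower.1 ha b hb

theorem lower_mono (hab : a ≤ b) (hb : b ∈ x.lower) : a ∈ x.lower :=
  mem_lower.2 fun _ hu => hab.trans (lower_le_upper hb hu)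

theorem sup_mem_lower (ha : a ∈ x.lower) (hb : b ∈ x.lower) : a ⊔ b ∈ x.lower :=
  mem_lower.2 fun _ hu => sup_le (lower_le_upper ha hu) (lower_le_upper hb hu)

theorem lower_injective : Function.Injective (lower : Cut R → Set R) := fun x y h => by
  have h' : x.upper = y.upper := by rw [← x.upperBounds_lower, h, y.upperBounds_lower]
  cases x; cases y; simp_all

instance : PartialOrder (Cut R) := PartialOrder.lift lower lower_injective

theorem le_iff_lower : x ≤ y ↔ x.lower ⊆ y.lower := Iff.rfl

theorem le_iff : x ≤ y ↔ ∀ l ∈ x.lower, ∀ u ∈ y.upper, l ≤ u := by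
  simp only [le_iff_lower, subset_def, mem_lower (x := y)]

theorem le_iff_upper : x ≤ y ↔ y.upper ⊆ x.upper := by
  rw [le_iff, subset_def]
  simp only [mem_upper (x := x)]
  exact ⟨fun h u hu l hl => h l hl u hu, fun h l hl u hu => h u hu l hl⟩

theorem ext_upper (h : ∀ c, c ∈ x.upper ↔ c ∈ y.upper) : x = y :=
  le_antisymm (le_iff_upper.2 fun c => (h c).2) (le_iff_upper.2 fun c => (h c).1)

theorem ext_lower (h : ∀ c, c ∈ x.lower ↔ c ∈ y.lower) : x = y :=
  lower_injective (Set.ext h)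

/-- The least cut whose lower set contains `S`. -/
def ofSet (S : Set R) (hne : S.Nonempty) (hb : BddAbove S) : Cut R where
  lower := lowerBounds (upperBounds S)
  upper := upperBounds S
  lower_nonempty := hne.mono (subset_lowerBounds_upperBounds S)
  upper_nonempty := hb
  lowerBounds_upper := rfl
  upperBounds_lower := (gc_upperBounds_lowerBounds (α := R)).l_u_l_eq_l S

theorem mem_upper_ofSet {S : Set R} {hne : S.Nonempty} {hb : BddAbove S} :
    a ∈ (ofSet S hne hb).upper ↔ ∀ s ∈ S, s ≤ a := Iff.rfl

/-- The principal cut at `a`. -/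
def of (a : R) : Cut R where
  lower := Iic a
  upper := Ici a
  lower_nonempty := nonempty_Iic
  upper_nonempty := nonempty_Ici
  lowerBounds_upper := isLeast_Ici.isGLB.lowerBounds_eq
  upperBounds_lower := isGreatest_Iic.isLUB.upperBounds_eq

@[simp] theorem mem_lower_of : b ∈ (of a).lower ↔ b ≤ a := Iff.rfl

@[simp] theorem mem_upper_of : b ∈ (of a).upper ↔ a ≤ b := Iff.rfl

theorem of_le_iff : of a ≤ x ↔ a ∈ x.lower :=
  ⟨fun h => h (le_refl a), fun h _ hb => lower_mono hb h⟩

theorem le_of_iff : x ≤ of a ↔ a ∈ x.upper := mem_upper.symm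

theorem of_le_of : of a ≤ of b ↔ a ≤ b := of_le_iff

theorem of_injective : Function.Injective (of : R → Cut R) := fun _ _ h =>
  le_antisymm (of_le_of.1 h.le) (of_le_of.1 h.ge)

/-- Bounds of a union are intersections of bounds, so upper halves intersect for joins and lower
halves for meets; the opposite half is then the Galois closure. -/
instance : Lattice (Cut R) where
  sup x y :=
    { lower := lowerBounds (x.upper ∩ y.upper)
      upper := x.upper ∩ y.upper
      lower_nonempty := x.lower_nonempty.mono fun _ hl _ hu => lower_le_upper hl hu.1
      upper_nonempty := by
        obtain ⟨u, hu⟩ := x.upper_nonempty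
        obtain ⟨v, hv⟩ := y.upper_nonempty
        exact ⟨u ⊔ v, mem_upper.2 fun l hl => le_sup_of_le_left (lower_le_upper hl hu),
          mem_upper.2 fun l hl => le_sup_of_le_right (lower_le_upper hl hv)⟩
      lowerBounds_upper := rfl
      upperBounds_lower := by
        rw [← x.upperBounds_lower, ← y.upperBounds_lower, ← upperBounds_union]
        exact (gc_upperBounds_lowerBounds (α := R)).l_u_l_eq_l _ }
  le_sup_left x y := le_iff_upper.2 inter_subset_left
  le_sup_right x y := le_iff_upper.2 inter_subset_right
  sup_le x y z hx hy := le_iff_upper.2 (subset_inter (le_iff_upper.1 hx) (le_iff_upper.1 hy))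
  inf x y :=
    { lower := x.lower ∩ y.lower
      upper := upperBounds (x.lower ∩ y.lower)
      upper_nonempty := x.upper_nonempty.mono fun _ hu _ hl => lower_le_upper hl.1 hu
      lower_nonempty := by
        obtain ⟨u, hu⟩ := x.lower_nonempty
        obtain ⟨v, hv⟩ := y.lower_nonempty
        exact ⟨u ⊓ v, lower_mono inf_le_left hu, lower_mono inf_le_right hv⟩
      upperBounds_lower := rfl
      lowerBounds_upper := by
        rw [← x.lowerBounds_upper, ← y.lowerBounds_upper, ← lowerBounds_union]
        exact (gc_upperBounds_lowerBounds (α := R)).u_l_u_eq_u _ }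
  inf_le_left x y := inter_subset_left
  inf_le_right x y := inter_subset_right
  le_inf x y z hx hy := subset_inter hx hy

theorem mem_upper_sup : a ∈ (x ⊔ y).upper ↔ a ∈ x.upper ∧ a ∈ y.upper := Iff.rfl

theorem mem_lower_inf : a ∈ (x ⊓ y).lower ↔ a ∈ x.lower ∧ a ∈ y.lower := Iff.rfl

theorem of_sup (a b : R) : of (a ⊔ b) = of a ⊔ of b :=
  ext_upper fun c => by simp [mem_upper_sup]

theorem of_inf (a b : R) : of (a ⊓ b) = of a ⊓ of b :=
  ext_lower fun c => by simp [mem_lower_inf]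

theorem exists_isLUB {S : Set (Cut R)} (hne : S.Nonempty) (hb : BddAbove S) :
    ∃ x, IsLUB S x := by
  obtain ⟨x₀, hx₀⟩ := hne
  obtain ⟨z, hz⟩ := hb
  obtain ⟨u, hu⟩ := z.upper_nonempty
  obtain ⟨l, hl⟩ := x₀.lower_nonempty
  refine ⟨ofSet (⋃ x ∈ S, x.lower) ⟨l, mem_biUnion hx₀ hl⟩ ⟨u, fun a ha => ?_⟩, ?_, ?_⟩
  · obtain ⟨x, hx, ha⟩ := mem_iUnion₂.1 ha
    exact lower_le_upper (hz hx ha) hu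
  · exact fun x hx => le_iff.2 fun a ha v hv => mem_upper_ofSet.1 hv a (mem_biUnion hx ha)
  · refine fun y hy => le_iff_upper.2 fun v hv => mem_upper_ofSet.2 fun a ha => ?_
    obtain ⟨x, hx, ha⟩ := mem_iUnion₂.1 ha
    exact lower_le_upper (hy hx ha) hv

theorem isDedekindComplete : IsDedekindComplete (Cut R) := by
  rintro S ⟨x, hx⟩ hA hB
  refine ⟨exists_isLUB ⟨x, hx⟩ hA, ?_⟩
  obtain ⟨s, hs⟩ := exists_isLUB hB ⟨x, fun y hy => hy hx⟩
  exact ⟨s, isLUB_lowerBounds.1 hs⟩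

theorem isLUB_range_of_inter_Iic (x : Cut R) : IsLUB (range of ∩ Iic x) x := by
  refine ⟨fun _ h => h.2, fun y hy l hl => of_le_iff.1 (hy ⟨⟨l, rfl⟩, of_le_iff.2 hl⟩)⟩

theorem isGLB_range_of_inter_Ici (x : Cut R) : IsGLB (range of ∩ Ici x) x := by
  refine ⟨fun _ h => h.2, fun y hy => le_iff_upper.2 fun u hu =>
    le_of_iff.1 (hy ⟨⟨u, rfl⟩, le_of_iff.2 hu⟩)⟩

theorem isLUB_image_of {S : Set R} (h : IsLUB S a) : IsLUB (of '' S) (of a) := by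
  refine ⟨?_, fun x hx => le_iff_upper.2 fun u hu => h.2 fun s hs => ?_⟩
  · rintro _ ⟨s, hs, rfl⟩
    exact of_le_of.2 (h.1 hs)
  · exact lower_le_upper (of_le_iff.1 (hx ⟨s, hs, rfl⟩)) hu

theorem isGLB_image_of {S : Set R} (h : IsGLB S a) : IsGLB (of '' S) (of a) := by
  refine ⟨?_, fun x hx l hl => h.2 fun s hs => ?_⟩
  · rintro _ ⟨s, hs, rfl⟩
    exact of_le_of.2 (h.1 hs)
  · exact lower_le_upper hl (le_of_iff.1 (hx ⟨s, hs, rfl⟩))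

end Order

/-! ### Addition and negation of cuts -/

section AddMonoid

variable {R : Type*} [AddCommGroup R] [Lattice R] [IsOrderedAddMonoid R] {x y : Cut R} {a b c : R}

instance : Zero (Cut R) := ⟨of 0⟩

instance : Add (Cut R) where
  add x y := ofSet (image2 (· + ·) x.lower y.lower)
    (x.lower_nonempty.image2 y.lower_nonempty) <| by
      obtain ⟨u, hu⟩ := x.upper_nonempty
      obtain ⟨v, hv⟩ := y.upper_nonempty
      refine ⟨u + v, ?_⟩
      rintro _ ⟨a, ha, b, hb, rfl⟩
      exact add_le_add (lower_le_upper ha hu) (lower_le_upper hb hv)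

instance : Neg (Cut R) where
  neg x :=
    { lower := -x.upper
      upper := -x.lower
      lower_nonempty := x.upper_nonempty.neg
      upper_nonempty := x.lower_nonempty.neg
      lowerBounds_upper := by
        ext a
        rw [mem_neg, mem_upper, mem_lowerBounds]
        exact ⟨fun h l hl => le_neg.2 (h (-l) (by simpa using hl)),
          fun h l hl => by simpa using le_neg.1 (h (-l) hl)⟩
      upperBounds_lower := by
        ext a
        rw [mem_neg, mem_lower, mem_upperBounds]
        exact ⟨fun h l hl => neg_le.2 (h (-l) (by simpa using hl)),
          fun h l hl => by simpa using neg_le.1 (h (-l) hl)⟩ }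

theorem zero_def : (0 : Cut R) = of 0 := rfl

theorem mem_upper_add : c ∈ (x + y).upper ↔ ∀ a ∈ x.lower, ∀ b ∈ y.lower, a + b ≤ c := by
  change c ∈ (ofSet _ _ _).upper ↔ _
  rw [mem_upper_ofSet, forall_mem_image2]

theorem add_mem_lower (ha : a ∈ x.lower) (hb : b ∈ y.lower) : a + b ∈ (x + y).lower :=
  mem_lower.2 fun _ hu => mem_upper_add.1 hu a ha b hb

theorem add_mem_upper (ha : a ∈ x.upper) (hb : b ∈ y.upper) : a + b ∈ (x + y).upper :=
  mem_upper_add.2 fun _ hl _ hm => add_le_add (lower_le_upper hl ha) (lower_le_upper hm hb)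

/-- An element of the lower half of a sum may fail to be a sum, but upper bounds can be tested on
sums alone. This is what makes associativity work, after moving the remaining summand across `≤`. -/
theorem forall_mem_lower_add :
    (∀ d ∈ (x + y).lower, d ≤ c) ↔ ∀ a ∈ x.lower, ∀ b ∈ y.lower, a + b ≤ c := by
  rw [← mem_upper, mem_upper_add]

theorem mem_lower_neg : a ∈ (-x).lower ↔ -a ∈ x.upper := Iff.rfl

theorem mem_upper_neg : a ∈ (-x).upper ↔ -a ∈ x.lower := Iff.rfl

theorem of_add (a b : R) : of (a + b) = of a + of b := by
  refine ext_upper fun c => ?_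
  rw [mem_upper_add]
  exact ⟨fun h a' ha b' hb => (add_le_add ha hb).trans h, fun h => h a le_rfl b le_rfl⟩

theorem of_neg (a : R) : of (-a) = -of a :=
  ext_upper fun c => by simp [mem_upper_neg, neg_le]

protected theorem add_comm (x y : Cut R) : x + y = y + x := by
  refine ext_upper fun c => ?_
  rw [mem_upper_add, mem_upper_add]
  constructor <;> intro h a ha b hb <;> rw [add_comm] <;> exact h b hb a ha

instance : AddCommMonoid (Cut R) where
  add_assoc x y z := by
    refine ext_upper fun c => ?_
    have h₁ : c ∈ (x + y + z).upper ↔ ∀ a ∈ x.lower, ∀ b ∈ y.lower, ∀ d ∈ z.lower,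
        a + b + d ≤ c := by
      rw [mem_upper_add]
      constructor
      · exact fun h a ha b hb d hd => h _ (add_mem_lower ha hb) d hd
      · intro h e he d hd
        rw [← le_sub_iff_add_le]
        exact forall_mem_lower_add.2 (fun a ha b hb => le_sub_iff_add_le.2 (h a ha b hb d hd)) e he
    have h₂ : c ∈ (x + (y + z)).upper ↔ ∀ a ∈ x.lower, ∀ b ∈ y.lower, ∀ d ∈ z.lower,
        a + (b + d) ≤ c := by
      rw [mem_upper_add]
      constructor
      · exact fun h a ha b hb d hd => h a ha _ (add_mem_lower hb hd)
      · intro h a ha e he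
        rw [← le_sub_iff_add_le']
        exact forall_mem_lower_add.2 (fun b hb d hd => le_sub_iff_add_le'.2 (h a ha b hb d hd)) e he
    simp only [h₁, h₂, add_assoc]
  zero_add x := by
    refine ext_upper fun c => ?_
    rw [mem_upper_add, mem_upper]
    refine ⟨fun h l hl => by simpa using h 0 le_rfl l hl, fun h a ha b hb => ?_⟩
    exact (add_le_of_nonpos_left ha).trans (h b hb)
  add_zero x := by
    refine ext_upper fun c => ?_
    rw [mem_upper_add, mem_upper]
    refine ⟨fun h l hl => by simpa using h l hl 0 le_rfl, fun h a ha b hb => ?_⟩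
    exact (add_le_of_nonpos_right hb).trans (h a ha)
  add_comm := Cut.add_comm
  nsmul := nsmulRec

instance : IsOrderedAddMonoid (Cut R) where
  add_le_add_left _ _ h _ := le_iff_upper.2 fun _ hu =>
    mem_upper_add.2 fun a ha b hb => mem_upper_add.1 hu a (h ha) b hb

end AddMonoid

end Cut

/-! ### Scalar multiplication, from nonnegative to real scalars -/

open scoped NNReal

/-- An additive group with a semimodule structure over `ℝ≥0` is a real vector space. -/
abbrev moduleOfNNReal {M : Type*} [AddCommGroup M] [Module ℝ≥0 M] : Module ℝ M :=
  let act (r : ℝ) (x : M) : M := r.toNNReal • x - (-r).toNNReal • x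
  -- The action may be computed from any way of writing the scalar as a difference, so the module
  -- laws reduce to those over `ℝ≥0`.
  have key (p q : ℝ≥0) (x : M) : act ((p : ℝ) - q) x = p • x - q • x := by
    have h : ((p : ℝ) - q).toNNReal + q = (-((p : ℝ) - q)).toNNReal + p := by
      rw [← NNReal.coe_inj, NNReal.coe_add, NNReal.coe_add, Real.coe_toNNReal', Real.coe_toNNReal']
      rcases le_total (p : ℝ) q with h | h
      · rw [max_eq_right (by linarith), max_eq_left (by linarith)]; ring
      · rw [max_eq_left (by linarith), max_eq_right (by linarith)]; ring
    rw [sub_eq_sub_iff_add_eq_add, ← add_smul, ← add_smul, h, add_comm]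
  have split (r : ℝ) : ∃ p q : ℝ≥0, r = p - q :=
    ⟨r.toNNReal, (-r).toNNReal, by
      rw [Real.coe_toNNReal', Real.coe_toNNReal', max_comm, max_comm (-r), ← max_zero_sub_eq_self r]
      simp [max_comm]⟩
  { smul := act
    one_smul := fun x => by
      change act 1 x = x
      have := key 1 0 x
      simpa using this
    mul_smul := fun r s x => by
      change act (r * s) x = act r (act s x)
      obtain ⟨p, q, rfl⟩ := split r
      obtain ⟨p', q', rfl⟩ := split s
      have : ((p : ℝ) - q) * (p' - q') = ((p * p' + q * q' : ℝ≥0) : ℝ) - (p * q' + q * p' : ℝ≥0) := by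
        push_cast; ring
      rw [this, key, key, key]
      simp only [add_smul, mul_smul, smul_sub]
      abel
    smul_zero := fun r => by
      change act r 0 = 0
      simp [act]
    smul_add := fun r x y => by
      change act r (x + y) = act r x + act r y
      simp only [act, smul_add]
      abel
    add_smul := fun r s x => by
      change act (r + s) x = act r x + act s x
      obtain ⟨p, q, rfl⟩ := split r
      obtain ⟨p', q', rfl⟩ := split s
      have : ((p : ℝ) - q) + (p' - q') = ((p + p' : ℝ≥0) : ℝ) - (q + q' : ℝ≥0) := by
        push_cast; ring
      rw [this, key, key, key]
      simp only [add_smul]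
      abel
    zero_smul := fun x => by
      change act 0 x = 0
      simp [act] }

theorem moduleOfNNReal_smul {M : Type*} [AddCommGroup M] [Module ℝ≥0 M] {r : ℝ} (hr : 0 ≤ r)
    (x : M) : (moduleOfNNReal (M := M)).smul r x = r.toNNReal • x := by
  change r.toNNReal • x - (-r).toNNReal • x = _
  rw [Real.toNNReal_of_nonpos (neg_nonpos.2 hr), zero_smul, sub_zero]

namespace Cut

variable {R : Type*} [AddCommGroup R] [Lattice R] [IsOrderedAddMonoid R]
  [Module ℝ R] [IsOrderedModule ℝ R]

section NNReal

/-- Multiplication of a cut by a nonnegative scalar. -/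
def nnsmul (r : ℝ≥0) (x : Cut R) : Cut R :=
  ofSet ((fun a => (r : ℝ) • a) '' x.lower) (x.lower_nonempty.image _) <| by
    obtain ⟨u, hu⟩ := x.upper_nonempty
    refine ⟨(r : ℝ) • u, ?_⟩
    rintro _ ⟨a, ha, rfl⟩
    exact smul_le_smul_of_nonneg_left (lower_le_upper ha hu) r.2

variable {x y : Cut R} {a b c : R} {r : ℝ≥0}

theorem mem_upper_nnsmul : c ∈ (nnsmul r x).upper ↔ ∀ a ∈ x.lower, (r : ℝ) • a ≤ c := by
  rw [nnsmul, mem_upper_ofSet, forall_mem_image]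

theorem smul_mem_lower_nnsmul (ha : a ∈ x.lower) : (r : ℝ) • a ∈ (nnsmul r x).lower :=
  mem_lower.2 fun _ hu => mem_upper_nnsmul.1 hu a ha

theorem zero_nnsmul (x : Cut R) : nnsmul 0 x = 0 := by
  refine ext_upper fun c => ?_
  rw [mem_upper_nnsmul, zero_def, mem_upper_of]
  obtain ⟨a, ha⟩ := x.lower_nonempty
  exact ⟨fun h => by simpa using h a ha, fun h b _ => by simpa using h⟩

theorem nnsmul_zero (r : ℝ≥0) : nnsmul r (0 : Cut R) = 0 := by
  refine ext_upper fun c => ?_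
  rw [mem_upper_nnsmul, zero_def, mem_upper_of]
  exact ⟨fun h => by simpa using h 0 le_rfl,
    fun h b hb => (smul_nonpos_of_nonneg_of_nonpos r.2 hb).trans h⟩

theorem one_nnsmul (x : Cut R) : nnsmul 1 x = x :=
  ext_upper fun c => by simp [mem_upper_nnsmul, mem_upper (x := x)]

theorem mul_nnsmul (r s : ℝ≥0) (x : Cut R) : nnsmul (r * s) x = nnsmul r (nnsmul s x) := by
  rcases eq_or_lt_of_le (zero_le (a := r)) with rfl | hr
  · simp only [zero_mul, zero_nnsmul]
  have hr' : (0 : ℝ) < r := hr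
  refine ext_upper fun c => ?_
  simp only [mem_upper_nnsmul, ← le_inv_smul_iff_of_pos hr', NNReal.coe_mul, mul_smul]
  rw [← mem_upper, mem_upper_nnsmul]

theorem nnsmul_add (r : ℝ≥0) (x y : Cut R) : nnsmul r (x + y) = nnsmul r x + nnsmul r y := by
  rcases eq_or_lt_of_le (zero_le (a := r)) with rfl | hr
  · simp only [zero_nnsmul, add_zero]
  have hr' : (0 : ℝ) < r := hr
  refine ext_upper fun c => ?_
  simp only [mem_upper_nnsmul, ← le_inv_smul_iff_of_pos hr', forall_mem_lower_add, mem_upper_add]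
  simp only [le_inv_smul_iff_of_pos hr', smul_add]
  constructor
  · intro h a ha b hb
    rw [← le_sub_iff_add_le]
    refine (mem_upper_nnsmul (x := x)).2 (fun a ha => ?_) |> fun h' => lower_le_upper ha h'
    rw [le_sub_comm]
    refine (mem_upper_nnsmul (x := y)).2 (fun b hb => ?_) |> fun h' => lower_le_upper hb h'
    rw [le_sub_iff_add_le']
    exact h a ha b hb
  · exact fun h a ha b hb => h _ (smul_mem_lower_nnsmul ha) _ (smul_mem_lower_nnsmul hb)

theorem add_nnsmul (r s : ℝ≥0) (x : Cut R) : nnsmul (r + s) x = nnsmul r x + nnsmul s x := by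
  refine ext_upper fun c => ?_
  simp only [mem_upper_nnsmul, mem_upper_add, NNReal.coe_add, add_smul]
  constructor
  · intro h a ha b hb
    rw [← le_sub_iff_add_le]
    refine (mem_upper_nnsmul (x := x)).2 (fun a ha => ?_) |> fun h' => lower_le_upper ha h'
    rw [le_sub_comm]
    refine (mem_upper_nnsmul (x := x)).2 (fun b hb => ?_) |> fun h' => lower_le_upper hb h'
    rw [le_sub_iff_add_le']
    -- The two summands use different lower elements; their join, still in the lower half, dominates
    -- both.
    exact (add_le_add (smul_le_smul_of_nonneg_left le_sup_left r.2)
      (smul_le_smul_of_nonneg_left le_sup_right s.2)).trans (h _ (sup_mem_lower ha hb))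
  · exact fun h a ha => h _ (smul_mem_lower_nnsmul ha) _ (smul_mem_lower_nnsmul ha)

/-- The action of the nonnegative reals on cuts. -/
abbrev nnrealModule : Module ℝ≥0 (Cut R) where
  smul := nnsmul
  one_smul := one_nnsmul
  mul_smul := mul_nnsmul
  smul_zero := nnsmul_zero
  smul_add := nnsmul_add
  add_smul := add_nnsmul
  zero_smul := zero_nnsmul

end NNReal

/-! ### The Riesz space of cuts of an Archimedean space -/

variable [hR : Fact (IsArchimedean R)]

/-- If `c` bounds every difference `a - v` across the cut, then subtracting `c` maps the lower half
into itself. Iterating, `l - n • c ≤ u` for all `n`, and the Archimedean property gives `0 ≤ c`. -/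
protected theorem neg_add_cancel (x : Cut R) : -x + x = 0 := by
  refine ext_upper fun c => ?_
  rw [mem_upper_add, zero_def, mem_upper_of]
  constructor
  · intro h
    obtain ⟨l, hl⟩ := x.lower_nonempty
    obtain ⟨u, hu⟩ := x.upper_nonempty
    have step : ∀ a ∈ x.lower, a - c ∈ x.lower := fun a ha => mem_lower.2 fun v hv => by
      have := h (-v) (by simpa [mem_lower_neg] using hv) a ha
      rw [neg_add_le_iff_le_add] at this
      rwa [sub_le_iff_le_add]
    have iter (n : ℕ) : l - (n : ℝ) • c ∈ x.lower := by
      induction n with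
      | zero => simpa using hl
      | succ n ih =>
        have := step _ ih
        rwa [sub_sub, show (n : ℝ) • c + c = ((n + 1 : ℕ) : ℝ) • c by push_cast; rw [add_smul, one_smul]]
          at this
    refine neg_nonpos.1 (hR.out.nonpos_of_forall_smul_le (d := u - l) fun n => ?_)
    rw [smul_neg, le_sub_iff_add_le', ← sub_eq_add_neg]
    exact lower_le_upper (iter n) hu
  · intro h a ha b hb
    have := lower_le_upper hb (mem_lower_neg.1 ha)
    exact (le_neg_iff_add_nonpos_left.1 this).trans h

instance : AddCommGroup (Cut R) where
  neg_add_cancel := Cut.neg_add_cancel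
  add_comm := Cut.add_comm
  zsmul := zsmulRec

instance : Module ℝ (Cut R) :=
  letI := nnrealModule (R := R)
  moduleOfNNReal

variable {x : Cut R} {a c : R} {r : ℝ}

theorem smul_eq_nnsmul (hr : 0 ≤ r) (x : Cut R) : r • x = nnsmul r.toNNReal x :=
  letI := nnrealModule (R := R)
  moduleOfNNReal_smul hr x

theorem mem_upper_smul (hr : 0 ≤ r) : c ∈ (r • x).upper ↔ ∀ a ∈ x.lower, r • a ≤ c := by
  rw [smul_eq_nnsmul hr, mem_upper_nnsmul, Real.coe_toNNReal r hr]

theorem mem_upper_smul_of_pos (hr : 0 < r) : c ∈ (r • x).upper ↔ r⁻¹ • c ∈ x.upper := by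
  rw [mem_upper_smul hr.le, mem_upper]
  simp only [le_inv_smul_iff_of_pos hr]

theorem mem_lower_smul_of_pos (hr : 0 < r) : c ∈ (r • x).lower ↔ r⁻¹ • c ∈ x.lower := by
  rw [mem_lower, mem_lower]
  constructor
  · intro h u hu
    rw [inv_smul_le_iff_of_pos hr]
    exact h _ ((mem_upper_smul_of_pos hr).2 (by rwa [inv_smul_smul₀ hr.ne']))
  · intro h u hu
    have := h _ ((mem_upper_smul_of_pos hr).1 hu)
    rwa [inv_smul_le_iff_of_pos hr, smul_inv_smul₀ hr.ne'] at this

instance : IsOrderedModule ℝ (Cut R) where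
  smul_le_smul_of_nonneg_left r hr x y h := le_iff_upper.2 fun c hc =>
    (mem_upper_smul hr).2 fun a ha => (mem_upper_smul hr).1 hc a (h ha)
  smul_le_smul_of_nonneg_right x hx r s h := by
    rw [← sub_nonneg, ← sub_smul]
    refine le_iff.2 fun l hl u hu => ?_
    have := (mem_upper_smul (sub_nonneg.2 h)).1 hu 0 (hx le_rfl)
    rw [smul_zero] at this
    exact le_trans (α := R) hl this

theorem of_smul (r : ℝ) (a : R) : of (r • a) = r • of a := by
  have key {r : ℝ} (hr : 0 ≤ r) : of (r • a) = r • of a := by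
    refine ext_upper fun c => ?_
    rw [mem_upper_smul hr, mem_upper_of]
    exact ⟨fun h b hb => (smul_le_smul_of_nonneg_left hb hr).trans h, fun h => h a le_rfl⟩
  rcases le_total 0 r with hr | hr
  · exact key hr
  · have := key (neg_nonneg.2 hr)
    rwa [neg_smul, neg_smul, of_neg, neg_inj] at this

/-- The embedding of `R` into its space of cuts. -/
def ofₗ : R →ₗ[ℝ] Cut R where
  toFun := of
  map_add' := of_add
  map_smul' := of_smul

theorem isEmbedding_ofₗ : IsEmbedding (ofₗ : R →ₗ[ℝ] Cut R) := ⟨of_injective, of_sup, of_inf⟩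

theorem preservesBounds_ofₗ : PreservesBounds (ofₗ : R →ₗ[ℝ] Cut R) :=
  fun _ _ => ⟨isLUB_image_of, isGLB_image_of⟩

theorem exists_of_between (hx : 0 < x) : ∃ a : R, 0 < of a ∧ of a < x := by
  obtain ⟨l, hl, hl₀⟩ := Set.not_subset.1 hx.not_ge
  have h₀ : (0 : R) < l ⊔ 0 :=
    lt_of_le_of_ne le_sup_right fun h => hl₀ (show l ≤ 0 from sup_eq_right.1 h.symm)
  have hlt : of (l ⊔ 0) ≤ x := of_le_iff.2 (sup_mem_lower hl (hx.le le_rfl))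
  -- Halving makes the upper inequality strict, in case `x` is itself the cut of `l ⊔ 0`.
  have h₁ : (0 : R) < (2⁻¹ : ℝ) • (l ⊔ 0) := 
    (smul_nonneg (by norm_num) h₀.le).lt_of_ne' (smul_ne_zero (by norm_num) h₀.ne')
  have h₂ : (2⁻¹ : ℝ) • (l ⊔ 0) < l ⊔ 0 := by
    have : l ⊔ 0 = (2⁻¹ : ℝ) • (l ⊔ 0) + (2⁻¹ : ℝ) • (l ⊔ 0) := by
      rw [← add_smul]; norm_num
    conv_rhs => rw [this]
    exact lt_add_of_pos_left _ h₁
  have hof {a b : R} (h : a < b) : of a < of b :=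
    lt_of_le_of_ne (of_le_of.2 h.le) (of_injective.ne h.ne)
  exact ⟨_, hof h₁, (hof h₂).trans_le hlt⟩

theorem isStrongUnit_of {e : R} (he : IsStrongUnit e) : IsStrongUnit (of e) := by
  refine ⟨of_le_of.2 he.1, fun x => ?_⟩
  obtain ⟨l, hl⟩ := x.lower_nonempty
  obtain ⟨u, hu⟩ := x.upper_nonempty
  obtain ⟨n, hn⟩ := he.2 (|l| + |u|)
  refine ⟨n, ?_⟩
  rw [← of_smul]
  have h := (le_abs_self _).trans hn
  refine (abs_le'.2 ⟨(le_of_iff.2 hu).trans (of_le_of.2 ?_), ?_⟩)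
  · exact ((le_abs_self u).trans (le_add_of_nonneg_left (abs_nonneg l))).trans h
  · rw [neg_le, ← of_neg]
    refine le_trans (of_le_of.2 ?_) (of_le_iff.2 hl)
    rw [neg_le]
    exact ((neg_le_abs l).trans (le_add_of_nonneg_right (abs_nonneg u))).trans h

end Cut

/-! ### Minimality of the completion -/

theorem IsEmbedding.monotone {A B : Type*} [AddCommGroup A] [Lattice A]
    [Module ℝ A] [AddCommGroup B] [Lattice B] [Module ℝ B]
    {f : A →ₗ[ℝ] B} (hf : IsEmbedding f) : Monotone f := fun a b h => by
  rw [← sup_eq_right, ← hf.map_sup, sup_eq_right.2 h]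

theorem IsEmbedding.le_iff_le {A B : Type*} [AddCommGroup A] [Lattice A]
    [Module ℝ A] [AddCommGroup B] [Lattice B] [Module ℝ B]
    {f : A →ₗ[ℝ] B} (hf : IsEmbedding f) {a b : A} : f a ≤ f b ↔ a ≤ b := by
  rw [← sup_eq_right, ← hf.map_sup, hf.injective.eq_iff, sup_eq_right]

/-- Joining with `c` is nonexpansive: `s ⊔ c` exceeds `a ⊔ c` by at most `s - a`, and these
differences have infimum `0`. -/
theorem le_sup_of_isGLB {C : Type*} [AddCommGroup C] [Lattice C] [IsOrderedAddMonoid C]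
    {S : Set C} {a b c : C} (ha : IsGLB S a) (h : ∀ s ∈ S, b ≤ s ⊔ c) : b ≤ a ⊔ c := by
  have : b - (a ⊔ c) + a ≤ a := ha.2 fun s hs => by
    have h₁ : s ⊔ c ≤ (s - a) + (a ⊔ c) := by
      refine sup_le ?_ ?_
      · calc s = (s - a) + a := (sub_add_cancel s a).symm
          _ ≤ _ := add_le_add_right le_sup_left _
      · exact le_add_of_nonneg_of_le (sub_nonneg.2 (ha.1 hs)) le_sup_right
    have := (h s hs).trans h₁
    rwa [← sub_le_iff_le_add, ← le_sub_iff_add_le] at *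
  simpa using this

namespace Cut

variable {R : Type*} [AddCommGroup R] [Lattice R] [IsOrderedAddMonoid R]
  [Module ℝ R] [IsOrderedModule ℝ R] [hR : Fact (IsArchimedean R)]
  {C : Type*} [AddCommGroup C] [Lattice C] [IsOrderedAddMonoid C]
  [Module ℝ C] [IsOrderedModule ℝ C] {j : R →ₗ[ℝ] C}

theorem isGLB_upper_sub_lower (x : Cut R) :
    IsGLB {a | ∃ l ∈ x.lower, ∃ u ∈ x.upper, u - l = a} 0 := by
  refine ⟨?_, fun c hc => ?_⟩
  · rintro _ ⟨l, hl, u, hu, rfl⟩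
    exact sub_nonneg.2 (lower_le_upper hl hu)
  · have : -c ∈ (-x + x).upper := mem_upper_add.2 fun a ha b hb => by
      have := hc ⟨b, hb, -a, ha, rfl⟩
      rw [le_neg]
      simpa [sub_eq_add_neg, add_comm] using this
    rw [neg_add_cancel, zero_def, mem_upper_of] at this
    exact neg_nonneg.1 this

/-- Here `c - d` lies below the image of every gap `u - l`, and `j` preserves the infimum `0` of the
gaps. Separating elements are therefore unique. -/
theorem le_of_forall_mem_lower_upper (hb : PreservesBounds j) {x : Cut R} {c d : C} (hc : ∀ u ∈ x.upper, c ≤ j u)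
    (hd : ∀ l ∈ x.lower, j l ≤ d) : c ≤ d := by
  refine sub_nonpos.1 (((hb _ _).2 x.isGLB_upper_sub_lower).2 ?_ |>.trans_eq (map_zero j))
  rintro _ ⟨_, ⟨l, hl, u, hu, rfl⟩, rfl⟩
  rw [map_sub]
  exact sub_le_sub (hc u hu) (hd l hl)

/-- The value at a cut `x` of the extension of `j` is the element of `C` that separates the images
of the two halves of `x`. -/
theorem exists_separating (hC : IsDedekindComplete C) (hj : IsEmbedding j) (x : Cut R) :
    ∃ c : C, (∀ l ∈ x.lower, j l ≤ c) ∧ ∀ u ∈ x.upper, c ≤ j u := by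
  have := hC.exists_between (x.lower_nonempty.image j) (x.upper_nonempty.image j) (by
    rintro _ ⟨l, hl, rfl⟩ _ ⟨u, hu, rfl⟩
    exact hj.monotone (lower_le_upper hl hu))
  simpa only [forall_mem_image] using this

theorem exists_isEmbedding_extending (hC : IsDedekindComplete C) (hj : IsEmbedding j)
    (hb : PreservesBounds j) :
    ∃ k : Cut R →ₗ[ℝ] C, IsEmbedding k ∧ ∀ r : R, k (ofₗ r) = j r := by
  choose k hl hu using exists_separating (R := R) hC hj
  have unique {x : Cut R} {c : C} (h₁ : ∀ l ∈ x.lower, j l ≤ c) (h₂ : ∀ u ∈ x.upper, c ≤ j u) :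
      k x = c :=
    le_antisymm (le_of_forall_mem_lower_upper hb (hu x) h₁)
      (le_of_forall_mem_lower_upper hb h₂ (hl x))
  have glb (x : Cut R) : IsGLB (j '' x.upper) (k x) :=
    ⟨forall_mem_image.2 (hu x), fun c hc =>
      le_of_forall_mem_lower_upper hb (forall_mem_image.1 hc) (hl x)⟩
  have lub (x : Cut R) : IsLUB (j '' x.lower) (k x) :=
    ⟨forall_mem_image.2 (hl x), fun c hc =>
      le_of_forall_mem_lower_upper hb (hu x) (forall_mem_image.1 hc)⟩
  have mono {x y : Cut R} (h : x ≤ y) : k x ≤ k y :=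
    (lub x).2 (forall_mem_image.2 fun l hl' => hl y l (h hl'))
  have k_of (r : R) : k (of r) = j r :=
    unique (fun l h => hj.monotone h) (fun u h => hj.monotone h)
  have k_add (x y : Cut R) : k (x + y) = k x + k y := by
    refine unique (fun l h => ?_) (fun u h => ?_)
    · rw [← sub_le_iff_le_add]
      refine (glb x).2 (forall_mem_image.2 fun u hux => ?_)
      rw [sub_le_comm]
      refine (glb y).2 (forall_mem_image.2 fun v hvy => ?_)
      rw [sub_le_iff_le_add', ← map_add]
      exact hj.monotone (lower_le_upper h (add_mem_upper hux hvy))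
    · rw [← le_sub_iff_add_le]
      refine (lub x).2 (forall_mem_image.2 fun l hlx => ?_)
      rw [le_sub_comm]
      refine (lub y).2 (forall_mem_image.2 fun m hmy => ?_)
      rw [le_sub_iff_add_le', ← map_add]
      exact hj.monotone (mem_upper_add.1 h l hlx m hmy)
  let kAdd : Cut R →+ C := AddMonoidHom.mk' k k_add
  have k_neg (x : Cut R) : k (-x) = -k x := map_neg kAdd x
  have k_smul_pos {r : ℝ} (hr : 0 < r) (x : Cut R) : k (r • x) = r • k x := by
    refine unique (fun l h => ?_) (fun u h => ?_)
    · rw [← inv_smul_le_iff_of_pos hr, ← map_smul]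
      exact hl x _ ((mem_lower_smul_of_pos hr).1 h)
    · rw [← le_inv_smul_iff_of_pos hr, ← map_smul]
      exact hu x _ ((mem_upper_smul_of_pos hr).1 h)
  have k_smul (r : ℝ) (x : Cut R) : k (r • x) = r • k x := by
    rcases lt_trichotomy r 0 with hr | rfl | hr
    · have := k_smul_pos (neg_pos.2 hr) x
      rwa [neg_smul, neg_smul, k_neg, neg_inj] at this
    · rw [zero_smul, zero_smul]
      exact map_zero kAdd
    · exact k_smul_pos hr x
  have k_sup (x y : Cut R) : k (x ⊔ y) = k x ⊔ k y := by
    refine le_antisymm ((lub _).2 (forall_mem_image.2 fun l h => ?_))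
      (sup_le (mono le_sup_left) (mono le_sup_right))
    -- Distributivity replaces `k x` and `k y` by `j u` and `j v`, and `u ⊔ v` lies in the upper
    -- half of `x ⊔ y`.
    refine le_sup_of_isGLB (glb x) (forall_mem_image.2 fun u hux => ?_)
    rw [sup_comm]
    refine le_sup_of_isGLB (glb y) (forall_mem_image.2 fun v hvy => ?_)
    rw [← hj.map_sup]
    refine hj.monotone (lower_le_upper h (mem_upper_sup.2 ⟨?_, ?_⟩))
    · exact mem_upper.2 fun m hm => (lower_le_upper hm hux).trans le_sup_right
    · exact mem_upper.2 fun m hm => (lower_le_upper hm hvy).trans le_sup_left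
  have k_inf (x y : Cut R) : k (x ⊓ y) = k x ⊓ k y := by
    rw [← neg_neg (x ⊓ y), neg_inf, k_neg, k_sup, k_neg, k_neg, ← neg_inf, neg_neg]
  have k_le {x y : Cut R} (h : k x ≤ k y) : x ≤ y :=
    le_iff.2 fun l hlx u huy => hj.le_iff_le.1 ((hl x l hlx).trans (h.trans (hu y u huy)))
  exact ⟨⟨⟨k, k_add⟩, k_smul⟩,
    ⟨fun x y h => le_antisymm (k_le (le_of_eq h)) (k_le (ge_of_eq h)), k_sup, k_inf⟩, k_of⟩

theorem isDedekindCompletion_ofₗ :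
    IsDedekindCompletion.{v} (ofₗ : R →ₗ[ℝ] Cut R) where
  complete := isDedekindComplete
  embedding := isEmbedding_ofₗ
  orderDense _ hx := exists_of_between hx
  isLUB_below := isLUB_range_of_inter_Iic
  isGLB_above := isGLB_range_of_inter_Ici
  preserves := preservesBounds_ofₗ
  smallest := by
    intro C _ _ _ _ _ j hC hj hb
    exact exists_isEmbedding_extending hC hj hb

/-- The operator is carried to the range of `ofₗ`, which is majorizing because every cut has a
nonempty upper half. -/
theorem exists_nonneg_extension (D : R →ₗ[ℝ] R) (hD : ∀ a, 0 ≤ a → 0 ≤ D a) :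
    ∃ g : Cut R →ₗ[ℝ] Cut R, (∀ a, g (of a) = of (D a)) ∧ ∀ x, 0 ≤ x → 0 ≤ g x := by
  let e : R ≃ₗ[ℝ] LinearMap.range (ofₗ : R →ₗ[ℝ] Cut R) :=
    LinearEquiv.ofInjective ofₗ isEmbedding_ofₗ.injective
  let p : Cut R →ₗ.[ℝ] Cut R := ⟨LinearMap.range ofₗ, ofₗ ∘ₗ D ∘ₗ e.symm.toLinearMap⟩
  have hp (a : R) : p (e a) = of (D a) := by
    change of (D (e.symm (e a))) = of (D a)
    rw [e.symm_apply_apply]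
  have p_nonneg (x : p.domain) (hx : 0 ≤ (x : Cut R)) : 0 ≤ p x := by
    obtain ⟨a, rfl⟩ := e.surjective x
    rw [hp]
    exact of_le_of.2 (hD a (of_le_of.1 hx))
  have p_dense (y : Cut R) : ∃ x : p.domain, y ≤ (x : Cut R) := by
    obtain ⟨u, hu⟩ := y.upper_nonempty
    exact ⟨e u, le_of_iff.2 hu⟩
  obtain ⟨g, hg, hg₀⟩ := exists_linearMap_nonneg_extension isDedekindComplete p p_nonneg p_dense
  exact ⟨g, fun a => (hg (e a)).trans (hp a), hg₀⟩

end Cut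

end Riesz

theorem theorem4p9 {R : Type u} [AddCommGroup R] [Lattice R] [IsOrderedAddMonoid R]
    [Module ℝ R] [IsOrderedModule ℝ R] (e : R) (D : R →ₗ[ℝ] R)
    (hModal : Riesz.IsModal e D) (hArch : Riesz.IsArchimedean R)
    (hUnit : Riesz.IsStrongUnit e) :
    ∃ (B : Type u) (_ : AddCommGroup B) (_ : Lattice B) (_ : IsOrderedAddMonoid B)
      (_ : Module ℝ B) (_ : IsOrderedModule ℝ B) (ι : R →ₗ[ℝ] B) (Dbar : B →ₗ[ℝ] B),
      Riesz.IsDedekindComplete B ∧ Riesz.IsArchimedean B ∧ Riesz.IsStrongUnit (ι e) ∧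
      Riesz.IsModal (ι e) Dbar ∧
      Riesz.IsDedekindCompletion.{v} ι ∧
      ∀ f : R, Dbar (ι f) = ι (D f) := by
  have : Fact (Riesz.IsArchimedean R) := ⟨hArch⟩
  obtain ⟨g, hg, hg₀⟩ := Riesz.Cut.exists_nonneg_extension D fun a ha => by
    simpa [sup_eq_left.2 ha] using hModal.nonneg a
  refine ⟨Riesz.Cut R, inferInstance, inferInstance, inferInstance, inferInstance, inferInstance,
    Riesz.Cut.ofₗ, g, Riesz.Cut.isDedekindComplete, Riesz.Cut.isDedekindComplete.isArchimedean,
    Riesz.Cut.isStrongUnit_of hUnit, ⟨Riesz.Cut.of_le_of.2 hModal.unit_nonneg,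
      fun a => hg₀ _ le_sup_right, ?_⟩, Riesz.Cut.isDedekindCompletion_ofₗ, hg⟩
  exact (hg e).trans_le (Riesz.Cut.of_le_of.2 hModal.unit_decreasing)
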